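/- Let $n$ be a natural number and let $\mathcal P(n)$ be the set of positive definite real symmetric $n\times n$ matrices of determinant $1$. For a nonzero real symmetric $n\times n$ matrix $A$ put $A^\perp=\{X\in\mathcal P(n) : \operatorname{tr}(XA)=0\}$, which is called a hyperplane of $\mathcal P(n)$ if it is non-empty. Call a real symmetric matrix semi-definite if it is nonzero and either positive or negative semi-definite. Call a pair (pencil) $(A,B)$ of real symmetric matrices semi-definite if $A$ is semi-definite, or $B$ is semi-definite, or $A-\mu B$ is semi-definite for some $\mu\in\mathbb R$. A real number $\mu$ is a generalized eigenvalue of $(A,B)$ if $\det(A-\mu B)=0$. **Theorem.** Let $A,B$ be nonzero real symmetric $n\times n$ matrices such that $A^\perp$ and $B^\perp$ are hyperplanes (that is, non-empty). Then $A^\perp\cap B^\perp=\varnothing$ if and only if there is $Q\in GL(n,\mathbb R)$ such that the pencil $(A',B')=(Q^{\mathsf T}AQ,\,Q^{\mathsf T}BQ)$ satisfies at least one of the following: 1. $A'$ and $B'$ are diagonal, and the pencil $(A',B')$ is semi-definite; 2. $A'=\operatorname{diag}(A_1,\dots,A_m)$ and $B'=\operatorname{diag}(B_1,\dots,B_m)$,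 where for each $i$ the blocks $A_i$ and $B_i$ are square matrices of the same size $d_i\in\{1,2\}$, and there is a real number $\lambda$ which is a generalized eigenvalue of every pencil $(A_i,B_i)$ with $d_i=2$ and for which $A'-\lambda B'$ is semi-definite. -/

import Mathlib

namespace SelbergSpace

open Matrix

/-- The symmetric space `P(n)` in its symmetric matrices model: the positive definite real
symmetric `n × n` matrices of determinant one. -/
def P (n : ℕ) : Set (Matrix (Fin n) (Fin n) ℝ) :=
  {X | X.IsSymm ∧ X.det = 1 ∧ X.PosDef}

/-- The normal space `A⊥ = {X ∈ P(n) | tr (X A) = 0}` of a matrix `A`. For `A` symmetric and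
nonzero it is a hyperplane of `P(n)` as soon as it is nonempty. -/
def perp {n : ℕ} (A : Matrix (Fin n) (Fin n) ℝ) : Set (Matrix (Fin n) (Fin n) ℝ) :=
  {X | X ∈ P n ∧ (X * A).trace = 0}

/-- A *nonzero* matrix which is positive or negative semi-definite. -/
def IsSemidefinite {n : ℕ} (M : Matrix (Fin n) (Fin n) ℝ) : Prop :=
  M ≠ 0 ∧ (M.PosSemidef ∨ (-M).PosSemidef)

/-- The pencil `(A, B)` is semi-definite: `A`, or `B`, or some `A - μ B` with `μ` real is. -/
def IsSemidefinitePencil {n : ℕ} (A B : Matrix (Fin n) (Fin n) ℝ) : Prop :=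
  IsSemidefinite A ∨ IsSemidefinite B ∨ ∃ μ : ℝ, IsSemidefinite (A - μ • B)

/-- Generalized eigenvalues, in `ℂ ∪ {∞}`, of a real matrix pencil `(A, B)`. -/
def IsGeneralizedEigenvalue {n : ℕ} (A B : Matrix (Fin n) (Fin n) ℝ) : OnePoint ℂ → Prop
  | OnePoint.infty => B.det = 0
  | OnePoint.some z => (A.map Complex.ofReal - z • B.map Complex.ofReal).det = 0

/-- The `n × n` matrix `diag (M 0, …, M (m-1))`, where `M i` is square of size `d i` and
`d 0 + ⋯ + d (m-1) = n`; the blocks occupy consecutive intervals of indices, in order. -/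
def diagOfBlocks {n m : ℕ} (d : Fin m → ℕ) (hd : ∑ i, d i = n)
    (M : (i : Fin m) → Matrix (Fin (d i)) (Fin (d i)) ℝ) : Matrix (Fin n) (Fin n) ℝ :=
  Matrix.reindex (finSigmaFinEquiv.trans (finCongr hd)) (finSigmaFinEquiv.trans (finCongr hd))
    (Matrix.blockDiagonal' M)

/-- The pencil `(A, B)` is diagonal and semi-definite. -/
def IsDiagonalSemidefinite {n : ℕ} (A B : Matrix (Fin n) (Fin n) ℝ) : Prop :=
  A.IsDiag ∧ B.IsDiag ∧ IsSemidefinitePencil A B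

/-- The pencil `(A, B)` is block-diagonal with blocks of dimension one or two, and there is a
real number `μ` which is a generalized eigenvalue of every two-dimensional block `(A i, B i)`
and for which `A - μ B` is semi-definite. -/
def IsBlockDiagonalSemidefinite {n : ℕ} (A B : Matrix (Fin n) (Fin n) ℝ) : Prop :=
  ∃ (m : ℕ) (d : Fin m → ℕ) (hd : ∑ i, d i = n)
    (As Bs : (i : Fin m) → Matrix (Fin (d i)) (Fin (d i)) ℝ) (μ : ℝ),
    (∀ i, 1 ≤ d i ∧ d i ≤ 2) ∧
    A = diagOfBlocks d hd As ∧ B = diagOfBlocks d hd Bs ∧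
    (∀ i, d i = 2 → IsGeneralizedEigenvalue (As i) (Bs i) (OnePoint.some (μ : ℂ))) ∧
    IsSemidefinite (A - μ • B)

end SelbergSpace

/-! The trace pairing of a positive definite matrix with a semi-definite one never vanishes, so a
semi-definite `A - μ • B` rules out a common point; congruence preserves semi-definiteness.
Conversely, if the hyperplanes are disjoint, the subspace `tr (M A) = tr (M B) = 0` misses the open
convex cone `posForm n`. Hahn–Banach separates the two, and the separating functional is the trace
against a combination of `A` and `B`, which is therefore semi-definite
(`exists_isSemidefinite_smul_add_smul`). Since `B` itself is not semi-definite, the combination can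
be scaled to `A - μ • B = ±S` with `S ≥ 0`. The pair `(S, B)` is then block-diagonalized by
repeatedly splitting off a line or a plane (`LinearMap.exists_dual_orthogonal`). Planes are needed
only when they meet the radical of `S`, and this makes `μ` a generalized eigenvalue of their blocks.
Thus disjointness always yields the second normal form. -/

open Module

/-! ### Splitting a pair of symmetric forms, one of them nonnegative -/

/-- A nonnegative symmetric bilinear form has every isotropic vector in its radical. -/
theorem LinearMap.eq_zero_of_nonneg_of_apply_self_eq_zero {V : Type*} [AddCommGroup V] [Module ℝ V]
    {S : V →ₗ[ℝ] V →ₗ[ℝ] ℝ} (hS : ∀ x y, S x y = S y x) (hS0 : ∀ x, 0 ≤ S x x)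
    {x : V} (hx : S x x = 0) : S x = 0 := by
  ext y
  by_contra hxy
  simp only [LinearMap.zero_apply] at hxy
  -- The coefficient `t` of `x` is chosen so that `2 * t * S x y + S y y = -1`.
  have h := hS0 (((-(S y y + 1)) / (2 * S x y)) • x + y)
  simp only [map_add, map_smul, LinearMap.add_apply, LinearMap.smul_apply, smul_eq_mul, hx,
    hS y x] at h
  have h2 : (-(S y y + 1)) / (2 * S x y) * S x y = -(S y y + 1) / 2 := by field_simp
  rw [h2] at h
  linarith

/-- A symmetric bilinear form has an eigenvector relative to a positive definite one. -/
theorem LinearMap.exists_relative_eigenvector {V : Type*} [AddCommGroup V] [Module ℝ V]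
    [FiniteDimensional ℝ V] [Nontrivial V] {S B : V →ₗ[ℝ] V →ₗ[ℝ] ℝ}
    (hS : ∀ x y, S x y = S y x) (hB : ∀ x y, B x y = B y x)
    (hS0 : ∀ x, 0 ≤ S x x) (hSd : ∀ x, S x x = 0 → x = 0) :
    ∃ (u : V) (c : ℝ), u ≠ 0 ∧ B u = c • S u := by
  have hinj : Function.Injective S := by
    rw [injective_iff_map_eq_zero]
    intro x hx
    exact hSd x (by rw [hx]; rfl)
  let e : V ≃ₗ[ℝ] Dual ℝ V := S.linearEquivOfInjective hinj Subspace.dual_finrank_eq.symm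
  let T : V →ₗ[ℝ] V := e.symm.toLinearMap ∘ₗ B
  have hT : ∀ x, S (T x) = B x := fun x => e.apply_symm_apply (B x)
  -- For the inner product `S`, the operator `T = S⁻¹ B` is self-adjoint, so it has an eigenvector.
  let core : InnerProductSpace.Core ℝ V :=
    { inner := fun x y => S x y
      conj_inner_symm := fun x y => hS y x
      re_inner_nonneg := hS0
      add_left := fun x y z => by simp
      smul_left := fun x y r => by simp
      definite := hSd }
  let : NormedAddCommGroup V := core.toNormedAddCommGroup
  let : InnerProductSpace ℝ V := InnerProductSpace.ofCore core.toCore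
  have hsymm : T.IsSymmetric := by
    intro x y
    change S (T x) y = S x (T y)
    rw [hT, hS x, hT, hB]
  obtain ⟨u, hu⟩ := hsymm.hasEigenvalue_iSup_of_finiteDimensional.exists_hasEigenvector
  exact ⟨u, _, hu.2, by rw [← hT, hu.apply_eq_smul, map_smul]⟩

/-- Vectors `u i` and functionals `f i` that are dual to each other split off the span of the
`u i`, with complement the common kernel of the `f i`. -/
noncomputable def LinearEquiv.piProdOfDual {V κ : Type*} [AddCommGroup V] [Module ℝ V] [Fintype κ]
    [DecidableEq κ] (u : κ → V) (f : κ → Dual ℝ V) (h : ∀ i j, f i (u j) = if i = j then 1 else 0) :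
    ((κ → ℝ) × (⨅ i, LinearMap.ker (f i) : Submodule ℝ V)) ≃ₗ[ℝ] V :=
  LinearEquiv.ofBijective
    ((Fintype.linearCombination ℝ u).coprod (⨅ i, LinearMap.ker (f i) : Submodule ℝ V).subtype) <| by
    have key : ∀ (c : κ → ℝ) i, f i (∑ j, c j • u j) = c i := by
      intro c i
      simp [h]
    constructor
    · rw [injective_iff_map_eq_zero]
      rintro ⟨c, w, hw⟩ hcw
      simp only [LinearMap.coprod_apply, Fintype.linearCombination_apply,
        Submodule.subtype_apply] at hcw
      have hc : c = 0 := by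
        ext i
        have := congrArg (f i) hcw
        rw [map_add, key, map_zero, LinearMap.mem_ker.1 ((Submodule.mem_iInf _).1 hw i),
          add_zero] at this
        exact this
      subst hc
      simpa using hcw
    · intro x
      refine ⟨(fun i => f i x, ⟨x - ∑ j, f j x • u j, ?_⟩), ?_⟩
      · rw [Submodule.mem_iInf]
        intro i
        rw [LinearMap.mem_ker, map_sub, key (fun j => f j x), sub_self]
      · simp [Fintype.linearCombination_apply]

theorem LinearEquiv.piProdOfDual_apply {V κ : Type*} [AddCommGroup V] [Module ℝ V] [Fintype κ]
    [DecidableEq κ] (u : κ → V) (f : κ → Dual ℝ V) (h : ∀ i j, f i (u j) = if i = j then 1 else 0)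
    (c : κ → ℝ) (w : (⨅ i, LinearMap.ker (f i) : Submodule ℝ V)) :
    LinearEquiv.piProdOfDual u f h (c, w) = ∑ i, c i • u i + w := rfl

/-- A pair of symmetric bilinear forms, the first of them nonnegative, splits off a subspace
of dimension one or two, and in dimension two this subspace meets the radical of the first form. -/
theorem LinearMap.exists_dual_orthogonal {V : Type*} [AddCommGroup V] [Module ℝ V]
    [FiniteDimensional ℝ V] [Nontrivial V] {S B : V →ₗ[ℝ] V →ₗ[ℝ] ℝ}
    (hS : ∀ x y, S x y = S y x) (hB : ∀ x y, B x y = B y x) (hS0 : ∀ x, 0 ≤ S x x) :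
    ∃ (k : ℕ) (u : Fin k → V) (f : Fin k → Dual ℝ V), 1 ≤ k ∧ k ≤ 2 ∧
      (∀ i j, f i (u j) = if i = j then 1 else 0) ∧
      (∀ w, (∀ i, f i w = 0) → ∀ i, S (u i) w = 0 ∧ B (u i) w = 0) ∧
      (k = 2 → ∃ j, S (u j) = 0) := by
  have one : ∀ (u : V) (f : Dual ℝ V), f u ≠ 0 → (∀ w, f w = 0 → S u w = 0 ∧ B u w = 0) →
      ∃ (k : ℕ) (u : Fin k → V) (f : Fin k → Dual ℝ V), 1 ≤ k ∧ k ≤ 2 ∧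
      (∀ i j, f i (u j) = if i = j then 1 else 0) ∧
      (∀ w, (∀ i, f i w = 0) → ∀ i, S (u i) w = 0 ∧ B (u i) w = 0) ∧
      (k = 2 → ∃ j, S (u j) = 0) := by
    intro u f hf hw
    refine ⟨1, fun _ => u, fun _ => (f u)⁻¹ • f, le_rfl, one_le_two, ?_, ?_, by simp⟩
    · intro i j
      simp [Subsingleton.elim i j, hf]
    · intro w h _
      apply hw
      simpa [hf] using h 0
  by_cases hd : ∀ x, S x x = 0 → x = 0
  · obtain ⟨u, c, hu, hc⟩ := exists_relative_eigenvector hS hB hS0 hd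
    refine one u (S u) (fun h => hu (hd u h)) fun w hw => ⟨hw, ?_⟩
    rw [hc, LinearMap.smul_apply, hw, smul_zero]
  push Not at hd
  obtain ⟨k, hk, hk0⟩ := hd
  replace hk : S k = 0 := eq_zero_of_nonneg_of_apply_self_eq_zero hS hS0 hk
  -- From here `S` has a radical. A radical vector that is not `B`-isotropic splits off with its
  -- `B`-orthogonal complement.
  by_cases hB0 : ∃ x, S x = 0 ∧ B x x ≠ 0
  · obtain ⟨x, hx, hBx⟩ := hB0
    exact one x (B x) hBx fun w hw => ⟨by rw [hx]; rfl, hw⟩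
  push Not at hB0
  by_cases hBk : B k = 0
  · obtain ⟨f, hf⟩ := not_forall.1 (mt (forall_dual_apply_eq_zero_iff ℝ k).1 hk0)
    exact one k f hf fun w _ => ⟨by rw [hk]; rfl, by rw [hBk]; rfl⟩
  -- Now `B` vanishes on the radical of `S`, by polarization, so `B k` annihilates `ker S` and is of
  -- the form `S u`.
  have hrange : B k ∈ LinearMap.range S := by
    have hflip : S.flip = S := by
      ext x y
      exact hS y x
    have := LinearMap.dualAnnihilator_ker_eq_range_flip (B := S)
    rw [hflip] at this
    rw [← this, Submodule.mem_dualAnnihilator]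
    intro w hw
    have h := hB0 (k + w) (by rw [map_add, hk, LinearMap.mem_ker.1 hw, add_zero])
    simp only [map_add, LinearMap.add_apply, hB0 k hk, hB0 w hw, hB w k] at h
    linarith
  obtain ⟨u, hu⟩ := hrange
  have hs : S u u ≠ 0 := fun h => hBk (by
    rw [← hu, eq_zero_of_nonneg_of_apply_self_eq_zero hS hS0 h])
  set s := S u u with hs'
  have hku : B k u = s := by rw [← hu]
  have huk : B u k = s := by rw [hB, hku]
  have hkk := hB0 k hk
  -- Since `B k k = 0` and `B k u = s`, subtracting this multiple of `k` makes the second vector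
  -- `B`-isotropic. The two vectors form a hyperbolic pair for `B`, so each is the other's dual
  -- functional through `B`.
  refine ⟨2, ![s⁻¹ • k, u - (B u u / (2 * s)) • k], ![B (u - (B u u / (2 * s)) • k), s⁻¹ • B k],
    one_le_two, le_rfl, ?_, ?_, fun _ => ⟨0, by simp [hk]⟩⟩
  · simp only [Fin.forall_fin_two]
    simp [hku, huk, hkk, hs]
    field_simp
    ring
  · intro w hw
    simp only [Fin.forall_fin_two] at hw ⊢
    simp [hs] at hw
    obtain ⟨h1, h2⟩ := hw
    simp [hk, hu, h2] at h1 ⊢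
    exact h1

/-- A pair of symmetric bilinear forms, the first of them nonnegative, is block diagonal in some
basis, with blocks of dimension one and two, where in the two-dimensional blocks the first form
is degenerate. -/
theorem LinearMap.exists_block_basis (n : ℕ) : ∀ {V : Type*} [AddCommGroup V] [Module ℝ V]
    [FiniteDimensional ℝ V] {S B : V →ₗ[ℝ] V →ₗ[ℝ] ℝ} (_ : finrank ℝ V = n)
    (_ : ∀ x y, S x y = S y x) (_ : ∀ x y, B x y = B y x) (_ : ∀ x, 0 ≤ S x x),
    ∃ (ι : Type) (_ : Fintype ι) (d : ι → ℕ) (b : Basis (Σ i, Fin (d i)) ℝ V),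
      (∀ i, 1 ≤ d i ∧ d i ≤ 2) ∧
      (∀ p q, p.1 ≠ q.1 → S (b p) (b q) = 0 ∧ B (b p) (b q) = 0) ∧
      (∀ i, d i = 2 → ∃ j, S (b ⟨i, j⟩) = 0) := by
  induction n using Nat.strong_induction_on with
  | _ n ih =>
  intro V _ _ _ S B hn hS hB hS0
  rcases subsingleton_or_nontrivial V with hV | hV
  · exact ⟨Empty, inferInstance, Empty.elim, Basis.empty V, by simp, by simp, by simp⟩
  obtain ⟨k, u, f, hk1, hk2, hfu, hort, hdeg⟩ := exists_dual_orthogonal hS hB hS0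
  set W : Submodule ℝ V := ⨅ i, LinearMap.ker (f i) with hW
  let e : ((Fin k → ℝ) × W) ≃ₗ[ℝ] V := LinearEquiv.piProdOfDual u f hfu
  have hrank : k + finrank ℝ W = n := by
    rw [← hn, ← e.finrank_eq, finrank_prod, finrank_fin_fun]
  have hperp : ∀ (w : W) i, S (u i) w = 0 ∧ B (u i) w = 0 := fun w =>
    hort w fun i => LinearMap.mem_ker.1 ((Submodule.mem_iInf _).1 w.2 i)
  obtain ⟨ι, _, d, b, hd, hb, hb2⟩ := ih (finrank ℝ W) (by omega)
    (S := S.domRestrict₁₂ W W) (B := B.domRestrict₁₂ W W) rfl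
    (fun x y => hS x y) (fun x y => hB x y) (fun x => hS0 x)
  let t : Unit ⊕ ι → ℕ := Sum.elim (fun _ => k) d
  let g : (Σ i, Fin (t i)) ≃ Fin k ⊕ (Σ i, Fin (d i)) :=
    (Equiv.sumSigmaDistrib fun i => Fin (t i)).trans
      (Equiv.sumCongr (Equiv.uniqueSigma fun _ : Unit => Fin k) (Equiv.refl _))
  let b₀ : Basis (Fin k ⊕ (Σ i, Fin (d i))) ℝ V := ((Pi.basisFun ℝ (Fin k)).prod b).map e
  have hb₀l : ∀ j, b₀ (Sum.inl j) = u j := by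
    intro j
    have : b₀ (Sum.inl j) = e (Pi.single j 1, 0) := by simp [b₀]
    rw [this, LinearEquiv.piProdOfDual_apply]
    simp [Pi.single_apply]
  have hb₀r : ∀ p, b₀ (Sum.inr p) = b p := by
    intro p
    have : b₀ (Sum.inr p) = e (0, b p) := by simp [b₀]
    rw [this, LinearEquiv.piProdOfDual_apply]
    simp
  let b' : Basis (Σ i, Fin (t i)) ℝ V := b₀.reindex g.symm
  have hinl : ∀ a (j : Fin (t (Sum.inl a))), b' ⟨Sum.inl a, j⟩ = u j :=
    fun a j => (b₀.reindex_apply g.symm _).trans (hb₀l j)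
  have hinr : ∀ i (j : Fin (t (Sum.inr i))), b' ⟨Sum.inr i, j⟩ = b ⟨i, j⟩ :=
    fun i j => (b₀.reindex_apply g.symm _).trans (hb₀r ⟨i, j⟩)
  have hdec : ∀ x : V, ∃ (c : Fin k → ℝ) (w : W), x = ∑ i, c i • u i + w := by
    intro x
    obtain ⟨⟨c, w⟩, rfl⟩ := e.surjective x
    exact ⟨c, w, rfl⟩
  refine ⟨Unit ⊕ ι, inferInstance, t, b', ?_, ?_, ?_⟩
  · rintro (_ | i)
    exacts [⟨hk1, hk2⟩, hd i]
  · rintro ⟨_ | i, j⟩ ⟨_ | i', j'⟩ hne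
    · exact absurd rfl hne
    · rw [hinl, hinr]
      exact hperp _ _
    · rw [hinl, hinr, hS, hB]
      exact hperp _ _
    · rw [hinr, hinr]
      exact hb ⟨i, j⟩ ⟨i', j'⟩ fun h => hne (congrArg Sum.inr h)
  · rintro (a | i) h
    · obtain ⟨j, hj⟩ := hdeg h
      exact ⟨j, (congrArg S (hinl a j)).trans hj⟩
    · obtain ⟨j, hj⟩ := hb2 i h
      refine ⟨j, (congrArg S (hinr i j)).trans ?_⟩
      ext x
      obtain ⟨c, w, rfl⟩ := hdec x
      -- Induction gives a radical vector of the restriction to `W` only; it is radical in `V`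
      -- because `W` is `S`-orthogonal to every `u i`.
      have hw := LinearMap.congr_fun hj w
      simp only [LinearMap.domRestrict₁₂_apply, LinearMap.zero_apply] at hw
      simp [hw, hS _ (u _), (hperp _ _).1]

open Matrix

/-! ### Semi-definite matrices and the trace pairing -/

namespace SelbergSpace

variable {n : ℕ} {A B M X : Matrix (Fin n) (Fin n) ℝ}

theorem IsSemidefinite.smul (hM : IsSemidefinite M) {c : ℝ} (hc : c ≠ 0) :
    IsSemidefinite (c • M) := by
  refine ⟨smul_ne_zero hc hM.1, ?_⟩
  rcases lt_or_gt_of_ne hc with h | h <;> rcases hM.2 with h' | h'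
  · exact Or.inr (by simpa using h'.smul (neg_nonneg.2 h.le))
  · exact Or.inl (by simpa using h'.smul (neg_nonneg.2 h.le))
  · exact Or.inl (h'.smul h.le)
  · exact Or.inr (by simpa using h'.smul h.le)

theorem IsSemidefinite.congruence (hM : IsSemidefinite M) (Q : GL (Fin n) ℝ) :
    IsSemidefinite (Q.valᵀ * M * Q.val) := by
  refine ⟨fun h => hM.1 ?_, ?_⟩
  · have hQ : IsUnit Q.val := Q.isUnit
    have hQt : IsUnit Q.valᵀ := (Matrix.isUnit_transpose _).2 hQ
    rwa [hQ.mul_left_eq_zero, hQt.mul_right_eq_zero] at h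
  · rcases hM.2 with h | h
    · exact Or.inl (by simpa using h.conjTranspose_mul_mul_same Q.val)
    · exact Or.inr (by simpa using h.conjTranspose_mul_mul_same Q.val)

theorem IsSemidefinite.of_congruence (Q : GL (Fin n) ℝ)
    (h : IsSemidefinite (Q.valᵀ * M * Q.val)) : IsSemidefinite M := by
  have := h.congruence Q⁻¹
  have h1 : Q.val * (Q⁻¹).val = 1 := by simp
  have h2 : ((Q⁻¹).val)ᵀ * Q.valᵀ = 1 := by rw [← transpose_mul, h1, transpose_one]
  have h3 : ((Q⁻¹).val)ᵀ * (Q.valᵀ * M * Q.val) * (Q⁻¹).val = M := by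
    calc _ = (((Q⁻¹).val)ᵀ * Q.valᵀ) * M * (Q.val * (Q⁻¹).val) := by simp only [Matrix.mul_assoc]
      _ = M := by rw [h1, h2, Matrix.one_mul, Matrix.mul_one]
  rwa [h3] at this

/-- With `X = Cᴴ * C` and `C` invertible, the trace is that of the positive semi-definite `C * M *
Cᴴ`, which vanishes only if `M` does. -/
theorem trace_mul_ne_zero_of_posSemidef (hX : X.PosDef) (hM : M.PosSemidef) (hM0 : M ≠ 0) :
    (X * M).trace ≠ 0 := by
  intro h
  obtain ⟨C, hC, rfl⟩ : ∃ C : Matrix (Fin n) (Fin n) ℝ, IsUnit C ∧ X = Cᴴ * C := by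
    open scoped MatrixOrder in
    obtain ⟨C, rfl⟩ := CStarAlgebra.nonneg_iff_eq_star_mul_self.1 hX.posSemidef.nonneg
    have : IsUnit (Cᴴ * C) := hX.isUnit
    exact ⟨C, isUnit_of_mul_isUnit_right this, rfl⟩
  have h' : (C * M * Cᴴ).trace = 0 := by
    rw [← h, Matrix.trace_mul_comm, ← Matrix.mul_assoc]
  rw [(hM.mul_mul_conjTranspose_same C).trace_eq_zero_iff] at h'
  have hCt : IsUnit Cᴴ := hC.star
  rw [hCt.mul_left_eq_zero, hC.mul_right_eq_zero] at h'
  exact hM0 h'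

theorem IsSemidefinite.trace_mul_ne_zero (hM : IsSemidefinite M) (hX : X.PosDef) :
    (X * M).trace ≠ 0 := by
  rcases hM.2 with h | h
  · exact trace_mul_ne_zero_of_posSemidef hX h hM.1
  · have := trace_mul_ne_zero_of_posSemidef hX h (neg_ne_zero.2 hM.1)
    simpa using this

theorem not_isSemidefinite_of_perp_nonempty (h : (perp A).Nonempty) : ¬ IsSemidefinite A := by
  obtain ⟨X, hX, hXA⟩ := h
  exact fun hA => hA.trace_mul_ne_zero hX.2.2 hXA

theorem disjoint_perp_of_isSemidefinite_sub {μ : ℝ} (h : IsSemidefinite (A - μ • B)) :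
    Disjoint (perp A) (perp B) := by
  rw [Set.disjoint_left]
  rintro X ⟨hX, hXA⟩ ⟨-, hXB⟩
  refine h.trace_mul_ne_zero hX.2.2 ?_
  rw [Matrix.mul_sub, Matrix.mul_smul, trace_sub, trace_smul, hXA, hXB]
  simp

/-- A positive definite matrix can be rescaled to determinant one. -/
theorem exists_smul_mem_P (hn : n ≠ 0) (hX : X.PosDef) : ∃ c : ℝ, 0 < c ∧ c • X ∈ P n := by
  have hdet := hX.det_pos
  refine ⟨(X.det⁻¹) ^ ((n : ℝ)⁻¹), by positivity, ?_, ?_, hX.smul (by positivity)⟩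
  · have := (hX.smul (by positivity : 0 < (X.det⁻¹) ^ ((n : ℝ)⁻¹))).isHermitian
    simpa [IsHermitian, IsSymm] using this
  · rw [det_smul, Fintype.card_fin, Real.rpow_inv_natCast_pow (by positivity) hn,
      inv_mul_cancel₀ hdet.ne']

/-- The trace conditions are homogeneous, so the determinant normalization can be dropped. -/
theorem trace_mul_ne_zero_of_disjoint_perp (hn : n ≠ 0) (h : Disjoint (perp A) (perp B))
    (hX : X.PosDef) (hXA : (X * A).trace = 0) : (X * B).trace ≠ 0 := by
  intro hXB
  obtain ⟨c, -, hc⟩ := exists_smul_mem_P hn hX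
  have hA : c • X ∈ perp A := ⟨hc, by simp [hXA]⟩
  exact Set.disjoint_left.1 h hA ⟨hc, by simp [hXB]⟩

/-! ### Separation by Hahn–Banach -/

/-- The matrices, not necessarily symmetric, with positive quadratic form. -/
def posForm (n : ℕ) : Set (Matrix (Fin n) (Fin n) ℝ) := {M | ∀ x, x ≠ 0 → 0 < x ⬝ᵥ (M *ᵥ x)}

/-- By homogeneity positivity need only hold on the compact unit sphere, where it is stable.
Allowing non-symmetric matrices is what makes the cone open in the full matrix space. -/
theorem isOpen_posForm : IsOpen (posForm n) := by
  have hEq : posForm n = {M | ∀ x ∈ Metric.sphere (0 : Fin n → ℝ) 1, 0 < x ⬝ᵥ (M *ᵥ x)} := by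
    ext M
    refine ⟨fun h x hx => h x ?_, fun h x hx => ?_⟩
    · rintro rfl
      simp at hx
    · have hx' : 0 < ‖x‖ := norm_pos_iff.2 hx
      have := h (‖x‖⁻¹ • x) (by simp [norm_smul, hx'.ne'])
      simp only [mulVec_smul, smul_dotProduct, dotProduct_smul, smul_eq_mul] at this
      have h1 : 0 < ‖x‖⁻¹ := inv_pos.2 hx'
      exact (mul_pos_iff_of_pos_left h1).1 ((mul_pos_iff_of_pos_left h1).1 this)
  rw [hEq, isOpen_iff_mem_nhds]
  intro M hM
  refine (isCompact_sphere (0 : Fin n → ℝ) 1).eventually_forall_of_forall_eventually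
    (P := fun M x => 0 < x ⬝ᵥ (M *ᵥ x)) fun x hx => ?_
  have hc : Continuous fun z : Matrix (Fin n) (Fin n) ℝ × (Fin n → ℝ) =>
      z.2 ⬝ᵥ (z.1 *ᵥ z.2) := by fun_prop
  exact hc.continuousAt.eventually_const_lt (hM x hx)

theorem convex_posForm : Convex ℝ (posForm n) := by
  intro M hM N hN a b ha hb hab x hx
  have h1 := hM x hx
  have h2 := hN x hx
  simp only [add_mulVec, smul_mulVec, dotProduct_add, dotProduct_smul, smul_eq_mul]
  rcases ha.eq_or_lt with rfl | ha
  · obtain rfl : b = 1 := by linarith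
    simpa using h2
  · exact add_pos_of_pos_of_nonneg (mul_pos ha h1) (mul_nonneg hb h2.le)

theorem dotProduct_self_pos {x : Fin n → ℝ} (hx : x ≠ 0) : 0 < x ⬝ᵥ x := by
  simpa using dotProduct_star_self_pos_iff.2 hx

theorem one_mem_posForm : (1 : Matrix (Fin n) (Fin n) ℝ) ∈ posForm n := by
  intro x hx
  simpa using dotProduct_self_pos hx

theorem posDef_add_transpose (hM : M ∈ posForm n) : (M + Mᵀ).PosDef := by
  refine PosDef.of_dotProduct_mulVec_pos ?_ fun x hx => ?_
  · simp [IsHermitian, add_comm]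
  · have h := hM x hx
    have h' : x ⬝ᵥ (Mᵀ *ᵥ x) = x ⬝ᵥ (M *ᵥ x) := by
      rw [mulVec_transpose, dotProduct_comm, dotProduct_mulVec]
    simp only [star_trivial, add_mulVec, dotProduct_add, h']
    linarith

theorem trace_add_transpose_mul (hA : A.IsSymm) :
    ((M + Mᵀ) * A).trace = 2 * (M * A).trace := by
  have : (Mᵀ * A).trace = (M * A).trace := by
    rw [← trace_transpose, transpose_mul, transpose_transpose, hA.eq, Matrix.trace_mul_comm]
  rw [Matrix.add_mul, trace_add, this, two_mul]

/-- A symmetric matrix pairing positively with `posForm n` is positive semi-definite. -/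
theorem posSemidef_of_forall_trace_pos (hA : A.IsSymm)
    (h : ∀ M ∈ posForm n, 0 < (M * A).trace) : A.PosSemidef := by
  refine PosSemidef.of_dotProduct_mulVec_nonneg (by simpa [IsHermitian] using hA.eq) fun x => ?_
  have key : ∀ ε : ℝ, 0 < ε → 0 ≤ x ⬝ᵥ (A *ᵥ x) + ε * A.trace := by
    intro ε hε
    -- The matrix `x xᵀ` may lie only on the boundary of the cone; adding `ε • 1` moves it inside.
    have := h (vecMulVec x x + ε • 1) (by
      intro y hy
      have hy' := dotProduct_self_pos hy
      simp only [add_mulVec, smul_mulVec, one_mulVec, dotProduct_add, dotProduct_smul,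
        vecMulVec_mulVec, smul_eq_mul, MulOpposite.smul_eq_mul_unop, MulOpposite.unop_op]
      rw [dotProduct_comm x y]
      have := mul_self_nonneg (y ⬝ᵥ x)
      have := mul_pos hε hy'
      linarith)
    rw [Matrix.add_mul, trace_add, vecMulVec_mul, trace_vecMulVec, dotProduct_comm,
      ← dotProduct_mulVec] at this
    simpa using this.le
  have ht : Filter.Tendsto (fun ε : ℝ => x ⬝ᵥ (A *ᵥ x) + ε * A.trace)
      (nhdsWithin 0 (Set.Ioi 0)) (nhds (x ⬝ᵥ (A *ᵥ x) + 0 * A.trace)) := by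
    apply Filter.Tendsto.mono_left _ nhdsWithin_le_nhds
    exact Continuous.tendsto (by fun_prop) 0
  have := ge_of_tendsto ht (by
    filter_upwards [self_mem_nhdsWithin] with ε hε using key ε hε)
  simpa using this

/-- The separation argument: if no positive definite matrix is orthogonal to both `A` and `B`, then
some linear combination of `A` and `B` is semi-definite. -/
theorem exists_isSemidefinite_smul_add_smul (hA : A.IsSymm) (hB : B.IsSymm)
    (h : ∀ X : Matrix (Fin n) (Fin n) ℝ, X.PosDef → (X * A).trace = 0 → (X * B).trace ≠ 0) :
    ∃ a b : ℝ, IsSemidefinite (a • A + b • B) := by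
  let T : Matrix (Fin n) (Fin n) ℝ → Matrix (Fin n) (Fin n) ℝ →ₗ[ℝ] ℝ := fun C =>
    (traceLinearMap (Fin n) ℝ ℝ) ∘ₗ LinearMap.mulRight ℝ C
  have hT : ∀ C M, T C M = (M * C).trace := fun _ _ => rfl
  let L : Fin 2 → Matrix (Fin n) (Fin n) ℝ →ₗ[ℝ] ℝ := ![T A, T B]
  let N : Submodule ℝ (Matrix (Fin n) (Fin n) ℝ) := ⨅ i, LinearMap.ker (L i)
  have hN : ∀ M, M ∈ N ↔ (M * A).trace = 0 ∧ (M * B).trace = 0 := by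
    intro M
    simp [N, L, Submodule.mem_iInf, Fin.forall_fin_two, hT]
  have hdisj : Disjoint (posForm n) (N : Set (Matrix (Fin n) (Fin n) ℝ)) := by
    rw [Set.disjoint_left]
    intro M hM hMN
    obtain ⟨h1, h2⟩ := (hN M).1 hMN
    refine h _ (posDef_add_transpose hM) ?_ ?_
    · rw [trace_add_transpose_mul hA, h1, mul_zero]
    · rw [trace_add_transpose_mul hB, h2, mul_zero]
  obtain ⟨f, u, hf1, hf2⟩ := geometric_hahn_banach_open convex_posForm isOpen_posForm N.convex hdisj
  have hu : u ≤ 0 := by simpa using hf2 0 N.zero_mem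
  -- A functional bounded below on a subspace vanishes there: otherwise a multiple of `M` takes the
  -- value `u - 1`.
  have hfN : ∀ M ∈ N, f M = 0 := by
    intro M hM
    by_contra hne
    have := hf2 (((u - 1) / f M) • M) (N.smul_mem _ hM)
    rw [map_smul, smul_eq_mul, div_mul_cancel₀ _ hne] at this
    linarith
  have hspan := mem_span_of_iInf_ker_le_ker (L := L) (K := f.toLinearMap) fun M hM => hfN M hM
  obtain ⟨c, hc⟩ := (Submodule.mem_span_range_iff_exists_fun ℝ).1 hspan
  have hfc : ∀ M, f M = (M * (c 0 • A + c 1 • B)).trace := by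
    intro M
    have := LinearMap.congr_fun hc M
    simp [Fin.sum_univ_two, L, hT] at this
    simp [Matrix.mul_add, ← this]
  have hneg : ∀ M ∈ posForm n, 0 < (M * -(c 0 • A + c 1 • B)).trace := by
    intro M hM
    have := hf1 M hM
    rw [hfc] at this
    rw [Matrix.mul_neg, trace_neg]
    linarith
  refine ⟨c 0, c 1, ?_, Or.inr (posSemidef_of_forall_trace_pos ?_ hneg)⟩
  · intro h0
    have := hneg 1 one_mem_posForm
    simp [h0] at this
  · exact ((hA.smul _).add (hB.smul _)).neg

/-- Disjoint hyperplanes have a semi-definite pencil. -/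
theorem exists_isSemidefinite_sub_smul (hA : A.IsSymm) (hB : B.IsSymm)
    (hA0 : A ≠ 0) (hAperp : (perp A).Nonempty) (hBperp : (perp B).Nonempty)
    (h : Disjoint (perp A) (perp B)) : ∃ μ : ℝ, IsSemidefinite (A - μ • B) := by
  have hn : n ≠ 0 := by
    rintro rfl
    exact hA0 (Subsingleton.elim _ _)
  obtain ⟨a, b, hab⟩ := exists_isSemidefinite_smul_add_smul hA hB fun X hX hXA =>
    trace_mul_ne_zero_of_disjoint_perp hn h hX hXA
  -- Otherwise `b • B` would be semi-definite, although `B⊥` is non-empty.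
  have ha : a ≠ 0 := by
    rintro rfl
    obtain ⟨X, hX, hXB⟩ := hBperp
    refine hab.trace_mul_ne_zero hX.2.2 ?_
    simp [hXB]
  refine ⟨-(a⁻¹ * b), ?_⟩
  have := hab.smul (inv_ne_zero ha)
  rwa [smul_add, smul_smul, smul_smul, inv_mul_cancel₀ ha, one_smul, ← sub_neg_eq_add,
    ← neg_smul] at this

end SelbergSpace

/-! ### From block bases to congruences -/

namespace SelbergSpace

variable {n : ℕ}

theorem bilin_apply (A : Matrix (Fin n) (Fin n) ℝ) (x y : Fin n → ℝ) :
    Matrix.toLinearMap₂' ℝ A x y = x ⬝ᵥ (A *ᵥ y) := Matrix.toLinearMap₂'_apply' A x y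

theorem bilin_symm {A : Matrix (Fin n) (Fin n) ℝ} (hA : A.IsSymm) (x y : Fin n → ℝ) :
    Matrix.toLinearMap₂' ℝ A x y = Matrix.toLinearMap₂' ℝ A y x := by
  rw [bilin_apply, bilin_apply, dotProduct_comm, ← vecMul_transpose, hA.eq, dotProduct_mulVec]

/-- A symmetric matrix whose entries outside the diagonal blocks vanish is a `diagOfBlocks`. -/
theorem eq_diagOfBlocks {m : ℕ} (d : Fin m → ℕ) (hd : ∑ i, d i = n)
    (M : Matrix (Fin n) (Fin n) ℝ)
    (h : ∀ p q : Σ i, Fin (d i), p.1 ≠ q.1 →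
      M ((finSigmaFinEquiv.trans (finCongr hd)) p) ((finSigmaFinEquiv.trans (finCongr hd)) q) = 0) :
    M = diagOfBlocks d hd fun i => Matrix.of fun j k =>
      M ((finSigmaFinEquiv.trans (finCongr hd)) ⟨i, j⟩)
        ((finSigmaFinEquiv.trans (finCongr hd)) ⟨i, k⟩) := by
  ext a b
  obtain ⟨⟨i, j⟩, rfl⟩ := (finSigmaFinEquiv.trans (finCongr hd)).surjective a
  obtain ⟨⟨i', j'⟩, rfl⟩ := (finSigmaFinEquiv.trans (finCongr hd)).surjective b
  rw [diagOfBlocks, Matrix.reindex_apply, Matrix.submatrix_apply, Equiv.symm_apply_apply,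
    Equiv.symm_apply_apply]
  by_cases hi : i = i'
  · subst hi
    rw [Matrix.blockDiagonal'_apply_eq, Matrix.of_apply]
  · rw [Matrix.blockDiagonal'_apply_ne _ _ _ hi]
    exact h _ _ hi

/-- A congruence brings a pair `(S, B)` with `S` positive semi-definite to block diagonal form. -/
theorem exists_congruence_blocks {S B : Matrix (Fin n) (Fin n) ℝ} (hS : S.PosSemidef)
    (hB : B.IsSymm) :
    ∃ (Q : GL (Fin n) ℝ) (m : ℕ) (d : Fin m → ℕ) (hd : ∑ i, d i = n), (∀ i, 1 ≤ d i ∧ d i ≤ 2) ∧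
      let e := finSigmaFinEquiv.trans (finCongr hd)
      (∀ p q : Σ i, Fin (d i), p.1 ≠ q.1 →
        (Q.valᵀ * S * Q.val) (e p) (e q) = 0 ∧ (Q.valᵀ * B * Q.val) (e p) (e q) = 0) ∧
      (∀ i, d i = 2 → ∃ j, ∀ k, (Q.valᵀ * S * Q.val) (e ⟨i, j⟩) (e ⟨i, k⟩) = 0) := by
  have hSs : S.IsSymm := by
    simpa [IsHermitian, IsSymm] using hS.isHermitian.eq
  obtain ⟨ι, _, d₀, b₀, hd₀, hort, hdeg⟩ := LinearMap.exists_block_basis n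
    (S := Matrix.toLinearMap₂' ℝ S) (B := Matrix.toLinearMap₂' ℝ B) (finrank_fin_fun ℝ)
    (bilin_symm hSs) (bilin_symm hB)
    (fun x => by rw [bilin_apply]; simpa using hS.dotProduct_mulVec_nonneg x)
  let r : Fin (Fintype.card ι) ≃ ι := (Fintype.equivFin ι).symm
  let d : Fin (Fintype.card ι) → ℕ := fun i => d₀ (r i)
  let g : (Σ i, Fin (d i)) ≃ Σ i, Fin (d₀ i) := Equiv.sigmaCongrLeft (β := fun i => Fin (d₀ i)) r
  let b : Basis (Σ i, Fin (d i)) ℝ (Fin n → ℝ) := b₀.reindex g.symm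
  have hb : ∀ i j, b ⟨i, j⟩ = b₀ ⟨r i, j⟩ := fun i j => b₀.reindex_apply g.symm _
  have hd : ∑ i, d i = n := by
    have := Module.finrank_eq_card_basis b
    simpa using this.symm
  let e := finSigmaFinEquiv.trans (finCongr hd)
  let c : Basis (Fin n) ℝ (Fin n → ℝ) := b.reindex e
  have hc : ∀ p, c (e p) = b p := fun p => by simp [c]
  -- The columns of `Q₀` are the basis vectors, so the congruence by `Q₀` gives the Gram matrices.
  let Q₀ : Matrix (Fin n) (Fin n) ℝ := Matrix.of fun i j => c j i
  have hQ₀ : IsUnit Q₀ := by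
    have : Q₀ = (Pi.basisFun ℝ (Fin n)).toMatrix c := by
      ext i j
      simp [Q₀, Basis.toMatrix_apply]
    rw [this]
    have := (Pi.basisFun ℝ (Fin n)).invertibleToMatrix c
    exact isUnit_of_invertible _
  have hQ : ∀ (A : Matrix (Fin n) (Fin n) ℝ) p q, (Q₀ᵀ * A * Q₀) (e p) (e q) =
      Matrix.toLinearMap₂' ℝ A (b p) (b q) := by
    intro A p q
    rw [bilin_apply, ← hc, ← hc, Matrix.mul_assoc, Matrix.mul_apply']
    rfl
  refine ⟨hQ₀.unit, _, d, hd, fun i => hd₀ _, ?_, ?_⟩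
  · rintro ⟨i, j⟩ ⟨i', j'⟩ hne
    rw [IsUnit.unit_spec, hQ, hQ, hb, hb]
    exact hort _ _ fun h => hne (r.injective h)
  · intro i hi
    obtain ⟨j, hj⟩ := hdeg (r i) hi
    refine ⟨j, fun k => ?_⟩
    rw [IsUnit.unit_spec, hQ, hb, hj]
    rfl

theorem isGeneralizedEigenvalue_of_row_eq_zero {k : ℕ} (A B : Matrix (Fin k) (Fin k) ℝ) (μ : ℝ)
    (j : Fin k) (h : ∀ l, (A - μ • B) j l = 0) :
    IsGeneralizedEigenvalue A B (OnePoint.some (μ : ℂ)) := by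
  refine Matrix.det_eq_zero_of_row_eq_zero j fun l => ?_
  have := congrArg Complex.ofReal (h l)
  simpa using this

/-- The blocks of `(S, B)` serve for `A = μ • B + c • S`. A null row of `S` in a plane block is a
null row of that block of `A - μ • B`. The scalar `c` covers both signs. -/
theorem exists_isBlockDiagonalSemidefinite_of_posSemidef {A B S : Matrix (Fin n) (Fin n) ℝ}
    {μ c : ℝ} (hB : B.IsSymm) (hS : S.PosSemidef) (hAB : A - μ • B = c • S)
    (h : IsSemidefinite (A - μ • B)) :
    ∃ Q : GL (Fin n) ℝ, IsBlockDiagonalSemidefinite (Q.valᵀ * A * Q.val) (Q.valᵀ * B * Q.val) := by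
  obtain ⟨Q, m, d, hd, hd12, hort, hdeg⟩ := exists_congruence_blocks hS hB
  have hsub : Q.valᵀ * A * Q.val - μ • (Q.valᵀ * B * Q.val) = Q.valᵀ * (A - μ • B) * Q.val := by
    simp [Matrix.mul_sub, Matrix.sub_mul]
  have hsub' : Q.valᵀ * A * Q.val - μ • (Q.valᵀ * B * Q.val) = c • (Q.valᵀ * S * Q.val) := by
    rw [hsub, hAB]
    simp
  have hA' : Q.valᵀ * A * Q.val = μ • (Q.valᵀ * B * Q.val) + c • (Q.valᵀ * S * Q.val) := by
    rw [← hsub']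
    abel
  refine ⟨Q, m, d, hd, _, _, μ, hd12, eq_diagOfBlocks d hd _ fun p q hpq => ?_,
    eq_diagOfBlocks d hd _ fun p q hpq => (hort p q hpq).2, fun i hi => ?_, ?_⟩
  · rw [hA', Matrix.add_apply, Matrix.smul_apply, Matrix.smul_apply, (hort p q hpq).1,
      (hort p q hpq).2]
    simp
  · obtain ⟨j, hj⟩ := hdeg i hi
    refine isGeneralizedEigenvalue_of_row_eq_zero _ _ μ j fun l => ?_
    have := congrFun (congrFun hsub' ((finSigmaFinEquiv.trans (finCongr hd)) ⟨i, j⟩))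
      ((finSigmaFinEquiv.trans (finCongr hd)) ⟨i, l⟩)
    rw [Matrix.smul_apply, hj l, smul_zero] at this
    exact this
  · rw [hsub]
    exact h.congruence Q

theorem exists_isBlockDiagonalSemidefinite {A B : Matrix (Fin n) (Fin n) ℝ} {μ : ℝ}
    (hB : B.IsSymm) (h : IsSemidefinite (A - μ • B)) :
    ∃ Q : GL (Fin n) ℝ, IsBlockDiagonalSemidefinite (Q.valᵀ * A * Q.val) (Q.valᵀ * B * Q.val) := by
  rcases h.2 with hS | hS
  · exact exists_isBlockDiagonalSemidefinite_of_posSemidef hB hS (one_smul ℝ _).symm h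
  · exact exists_isBlockDiagonalSemidefinite_of_posSemidef hB hS (c := -1) (by simp) h

end SelbergSpace

theorem mainTheorem2 (n : ℕ) (A B : Matrix (Fin n) (Fin n) ℝ)
    (hA : A.IsSymm) (hB : B.IsSymm) (hA0 : A ≠ 0) (hB0 : B ≠ 0)
    (hAperp : (SelbergSpace.perp A).Nonempty) (hBperp : (SelbergSpace.perp B).Nonempty) :
    Disjoint (SelbergSpace.perp A) (SelbergSpace.perp B) ↔
      ∃ Q : Matrix.GeneralLinearGroup (Fin n) ℝ,
        SelbergSpace.IsDiagonalSemidefinite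
            (Q.val.transpose * A * Q.val) (Q.val.transpose * B * Q.val) ∨
          SelbergSpace.IsBlockDiagonalSemidefinite
            (Q.val.transpose * A * Q.val) (Q.val.transpose * B * Q.val) := by
  constructor
  · intro h
    obtain ⟨μ, hμ⟩ := SelbergSpace.exists_isSemidefinite_sub_smul hA hB hA0 hAperp hBperp h
    obtain ⟨Q, hQ⟩ := SelbergSpace.exists_isBlockDiagonalSemidefinite hB hμ
    exact ⟨Q, Or.inr hQ⟩
  · rintro ⟨Q, hQ⟩
    have key : ∀ μ : ℝ, SelbergSpace.IsSemidefinite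
        (Q.val.transpose * A * Q.val - μ • (Q.val.transpose * B * Q.val)) →
        Disjoint (SelbergSpace.perp A) (SelbergSpace.perp B) := by
      intro μ hμ
      refine SelbergSpace.disjoint_perp_of_isSemidefinite_sub (μ := μ) (.of_congruence Q ?_)
      simpa [Matrix.mul_sub, Matrix.sub_mul] using hμ
    -- In the diagonal case, `A` or `B` being semi-definite contradicts non-emptiness of its
    -- hyperplane; what remains is `key`.
    rcases hQ with ⟨-, -, h | h | ⟨μ, h⟩⟩ | ⟨-, -, -, -, -, μ, -, -, -, -, h⟩
    · exact absurd (.of_congruence Q h) (SelbergSpace.not_isSemidefinite_of_perp_nonempty hAperp)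
    · exact absurd (.of_congruence Q h) (SelbergSpace.not_isSemidefinite_of_perp_nonempty hBperp)
    · exact key μ h
    · exact key μ h
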